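/- Let $\Phi=\{x_i\}\subset\mathbb R^2$ be a homogeneous Poisson point process of intensity $\lambda_t>0$ whose points are caches of size $N$, and let there be $M$ files, $1\le N<M$, indexed in order of decreasing popularity, with exclusion radii $r_1,\dots,r_M>0$. Attach to each point independently, for each file $m$, a mark that is uniform on $[0,1]$; all marks are independent of each other and of $\Phi$. A cache $x\in\Phi$ is \emph{selected} for file $m$ if its mark for file $m$ is the lowest among those of all points of $\Phi$ in the closed ball $B_x(r_m)$. In the hard-core placement (HCP), the files are processed in the order $m=1,\dots,M$; a cache stores file $m$ if it is selected for $m$ and is not yet full, i.e. has been selected for fewer than $N$ of the files $1,\dots,m-1$. Assume that the radii satisfy the cache constraint $\sum_{m=1}^M p(m)\le N$, where $p(m)=\mathbb E[1/(1+C_m)]$ with $C_m\sim\mathrm{Poisson}(\lambda_t\pi r_m^2)$ is the caching probability of file $m$. Let $R>0$ be the communication radius, and let $\mathcal N_P$ be the number of points of $\Phi$ in the closed ball $B_0(R)$. Then $\mathbb E[\mathcal N_P]=\lambda_t\pi R^2$ and the HCP placement underutilizes the caches: 1. if $\tilde C_m$ denotes the number of caches in $B_0(R)$ that are selected for file $m$,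 then $$\frac{1}{N\,\mathbb E[\mathcal N_P]}\sum_{m=1}^M\mathbb E[\tilde C_m]\le 1,\qquad\text{i.e.}\qquad \sum_{m=1}^M\mathbb E[\tilde C_m]\le N\lambda_t\pi R^2;$$ 2. the same holds if $\tilde C_m$ denotes the number of caches in $B_0(R)$ that store file $m$; 3. the average fraction of caches that contain $N$ distinct files is less than $1$: the expected number of caches in $B_0(R)$ that store exactly $N$ files, divided by $\mathbb E[\mathcal N_P]$, is strictly less than $1$. -/

import Mathlib

open MeasureTheory ProbabilityTheory
open scoped ENNReal

namespace HardCore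

/-- The plane with its Euclidean distance. -/
abbrev Plane : Type := EuclideanSpace ℝ (Fin 2)

section Points

variable {Ω : Type*} [MeasurableSpace Ω]

/-- The number of indices `i` for which the `i`-th point of the configuration lies in `A`. -/
noncomputable def count (X : ℕ → Ω → Plane) (A : Set Plane) (ω : Ω) : ℕ∞ :=
  {i : ℕ | X i ω ∈ A}.encard

/-- The random points `X 0, X 1, …` are (an enumeration of) a homogeneous Poisson point process
on the plane with intensity `lam`: the number of points in a bounded Borel set `A` is Poisson with
mean `lam * |A|`, and the numbers of points in finitely many disjoint bounded Borel sets are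
independent.  (For `lam > 0` such a process has infinitely many points almost surely, so that
the index set `ℕ` is the right one.) -/
structure IsPoissonProcess (P : Measure Ω) (lam : ℝ) (X : ℕ → Ω → Plane) : Prop where
  measurable : ∀ i, Measurable (X i)
  law_count : ∀ A : Set Plane, MeasurableSet A → Bornology.IsBounded A → ∀ k : ℕ,
    P {ω | count X A ω = k} = poissonMeasure (lam * (volume A).toReal).toNNReal {k}
  indep_count : ∀ (n : ℕ) (A : Fin n → Set Plane), (∀ j, MeasurableSet (A j)) →
    (∀ j, Bornology.IsBounded (A j)) → Pairwise (fun j l => Disjoint (A j) (A l)) →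
    iIndepFun (fun j => count X (A j)) P

/-- `U i m` is the mark that the `i`-th point carries for file `m`: all marks are independent and
uniformly distributed on `[0,1]`, and they are independent of the point process. -/
structure IsUniformMarking {M : ℕ} (P : Measure Ω) (X : ℕ → Ω → Plane)
    (U : ℕ → Fin M → Ω → ℝ) : Prop where
  measurable : ∀ i m, Measurable (U i m)
  uniform : ∀ i m, P.map (U i m) = volume.restrict (Set.Icc (0 : ℝ) 1)
  indep : iIndepFun (fun p : ℕ × Fin M => U p.1 p.2) P
  indep_points : IndepFun (fun ω (i : ℕ) => X i ω)
    (fun ω (p : ℕ × Fin M) => U p.1 p.2 ω) P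

end Points

section Placement

variable {Ω : Type*} {M : ℕ}

/-- The cache `i` is selected for file `m`: its mark for file `m` is the lowest one among the marks
for file `m` of all points in the closed ball of radius `r m` about it. -/
def Selected (r : Fin M → ℝ) (X : ℕ → Ω → Plane) (U : ℕ → Fin M → Ω → ℝ)
    (m : Fin M) (i : ℕ) (ω : Ω) : Prop :=
  ∀ j : ℕ, j ≠ i → X j ω ∈ Metric.closedBall (X i ω) (r m) → U i m ω < U j m ω

/-- The cache `i`, of size `N`, stores file `m`: it is selected for file `m` and it is not yet full,
that is, it has been selected for fewer than `N` of the files that precede `m`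
(the files are processed in the order of their indices). -/
def Stores (N : ℕ) (r : Fin M → ℝ) (X : ℕ → Ω → Plane) (U : ℕ → Fin M → Ω → ℝ)
    (m : Fin M) (i : ℕ) (ω : Ω) : Prop :=
  Selected r X U m i ω ∧ {l : Fin M | l < m ∧ Selected r X U l i ω}.ncard < N

/-- The number of caches within distance `R` of the origin (the typical receiver) that are
selected for file `m`. -/
noncomputable def selectedCount (r : Fin M → ℝ) (X : ℕ → Ω → Plane) (U : ℕ → Fin M → Ω → ℝ)
    (R : ℝ) (m : Fin M) (ω : Ω) : ℕ∞ :=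
  {i : ℕ | X i ω ∈ Metric.closedBall 0 R ∧ Selected r X U m i ω}.encard

/-- The number of caches within distance `R` of the origin that store file `m`. -/
noncomputable def storedCount (N : ℕ) (r : Fin M → ℝ) (X : ℕ → Ω → Plane)
    (U : ℕ → Fin M → Ω → ℝ) (R : ℝ) (m : Fin M) (ω : Ω) : ℕ∞ :=
  {i : ℕ | X i ω ∈ Metric.closedBall 0 R ∧ Stores N r X U m i ω}.encard

/-- The number of caches within distance `R` of the origin that contain `N` distinct files. -/
noncomputable def fullCount (N : ℕ) (r : Fin M → ℝ) (X : ℕ → Ω → Plane)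
    (U : ℕ → Fin M → Ω → ℝ) (R : ℝ) (ω : Ω) : ℕ∞ :=
  {i : ℕ | X i ω ∈ Metric.closedBall 0 R ∧ {m : Fin M | Stores N r X U m i ω}.ncard = N}.encard

end Placement

/-- The expectation of a random number with values in `{0, 1, 2, …, ∞}`. -/
noncomputable def expectedCount {Ω : Type*} [MeasurableSpace Ω] (P : Measure Ω)
    (Z : Ω → ℕ∞) : ℝ≥0∞ :=
  ∫⁻ ω, (Z ω : ℝ≥0∞) ∂P

/-- The caching probability `E[1 / (1 + C)]` of a file with exclusion radius `r`, where `C`, the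
number of neighbours of a typical cache within distance `r`, is Poisson with mean `lam * π * r ^ 2`:
given `C`, the typical cache has the lowest of `1 + C` marks. -/
noncomputable def cachingProb (lam r : ℝ) : ℝ :=
  ∫ k : ℕ, 1 / (1 + (k : ℝ)) ∂(poissonMeasure (lam * Real.pi * r ^ 2).toNNReal)

end HardCore

/-! The heart is the bound E[selected caches for `m`] ≤ λπR²·p(m). Given its number C of neighbours,
a cache has the lowest of 1 + C exchangeable marks with probability at most 1/(1 + C). No Palm
calculus is used to make "typical cache" precise. Instead, the disc is cut into cells A of radius δ
about centres c. A selected cache in A has the lowest mark in the ball D of radius r − δ about c,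
which contains A. Conditioning on the point positions bounds the mean number of such caches by
E[#A/#D]. This is at most E[#A/(1 + #D')], where D' is D minus the δ-ball about c. As D' is disjoint
from A, independence splits the expectation, the cells add up to the disc, and δ → 0 gives p(m)
(`expectedCount_selectedCount_le`).

The cache constraint then yields claim 1, and claim 2 follows because a stored file is a selected
one. For claim 3, with positive probability two nearby caches are ordered the same way by all files,
so one of them stays empty. -/

namespace HardCore

open scoped NNReal

/-! ### Poisson expectations -/

lemma lintegral_natCast_poissonMeasure (a : ℝ≥0) :
    ∫⁻ k : ℕ, (k : ℝ≥0∞) ∂(poissonMeasure a) = a := by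
  have hs : HasSum (fun n : ℕ => (n : ℝ) * (Real.exp (-a) * a ^ n / n.factorial)) a := by
    rw [← hasSum_nat_add_iff' 1]
    simp only [Finset.range_one, Finset.sum_singleton, Nat.cast_zero, zero_mul, sub_zero]
    convert! (hasSum_one_poissonMeasure a).mul_left (a : ℝ) using 1
    · ext n
      rw [Nat.factorial_succ, pow_succ]
      push_cast
      field_simp
    · simp
  rw [lintegral_countable']
  simp_rw [poissonMeasure_singleton]
  have h := ENNReal.ofReal_tsum_of_nonneg (fun n => by positivity) hs.summable
  rw [hs.tsum_eq, ENNReal.ofReal_coe_nnreal] at h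
  rw [h]
  congr 1 with n
  rw [ENNReal.ofReal_mul (by positivity), ENNReal.ofReal_natCast]

/-- Since 1/((k + 1)·k!) = 1/(k + 1)!, the sum is the Poisson series divided by a, without its
zeroth term exp(−a). -/
lemma integral_one_div_one_add_poissonMeasure {a : ℝ} (ha : 0 < a) :
    ∫ k : ℕ, 1 / (1 + (k : ℝ)) ∂(poissonMeasure a.toNNReal) = (1 - Real.exp (-a)) / a := by
  rw [integral_poissonMeasure, Real.coe_toNNReal _ ha.le]
  have h := hasSum_one_poissonMeasure a.toNNReal
  rw [Real.coe_toNNReal _ ha.le, ← hasSum_nat_add_iff' 1] at h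
  simp only [Finset.range_one, Finset.sum_singleton, pow_zero, mul_one, Nat.factorial_zero,
    Nat.cast_one, div_one] at h
  rw [← (h.div_const a).tsum_eq]
  congr 1 with n
  rw [Nat.factorial_succ, pow_succ, smul_eq_mul]
  push_cast
  field_simp
  ring

lemma lintegral_inv_one_add_poissonMeasure (a : ℝ≥0) :
    ∫⁻ k : ℕ, (1 + (k : ℝ≥0∞))⁻¹ ∂(poissonMeasure a) =
      ENNReal.ofReal (∫ k : ℕ, 1 / (1 + (k : ℝ)) ∂(poissonMeasure a)) := by
  have hb (k : ℕ) : 1 / (1 + (k : ℝ)) ≤ 1 :=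
    (div_le_one (by positivity)).2 (by linarith [k.cast_nonneg (α := ℝ)])
  rw [ofReal_integral_eq_lintegral_ofReal]
  · congr 1 with k
    rw [one_div, ENNReal.ofReal_inv_of_pos (by positivity),
      ENNReal.ofReal_add zero_le_one (by positivity), ENNReal.ofReal_one, ENNReal.ofReal_natCast]
  · refine Integrable.of_bound .of_discrete 1 (ae_of_all _ fun k => ?_)
    rw [Real.norm_of_nonneg (by positivity)]
    exact hb k
  · exact ae_of_all _ fun k => by positivity

/-! ### Laws and means of point counts -/

section Points

lemma encard_setOf_eq_tsum {ι : Type*} (p : ι → Prop) :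
    (({i | p i}.encard : ℕ∞) : ℝ≥0∞) = ∑' i, {i | p i}.indicator 1 i := by
  rw [← ENNReal.tsum_set_one, tsum_subtype {i | p i} (fun _ => (1 : ℝ≥0∞))]
  rfl

lemma encard_setOf_eq_tsum_indicator {Ω ι : Type*} (E : ι → Set Ω) (ω : Ω) :
    (({i | ω ∈ E i}.encard : ℕ∞) : ℝ≥0∞) = ∑' i, (E i).indicator 1 ω := by
  rw [encard_setOf_eq_tsum]
  rfl

variable {Ω : Type*} [MeasurableSpace Ω] {P : Measure Ω} {lam : ℝ} {X : ℕ → Ω → Plane}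

lemma expectedCount_eq_tsum (P : Measure Ω) {E : ℕ → Set Ω} (hE : ∀ i, MeasurableSet (E i)) :
    expectedCount P (fun ω => {i | ω ∈ E i}.encard) = ∑' i, P (E i) := by
  simp_rw [expectedCount, encard_setOf_eq_tsum_indicator]
  rw [lintegral_tsum fun i => (measurable_one.indicator (hE i)).aemeasurable]
  congr 1 with i
  exact lintegral_indicator_one (hE i)

lemma measurable_encard {E : ℕ → Set Ω} (hE : ∀ i, MeasurableSet (E i)) :
    Measurable (fun ω => {i | ω ∈ E i}.encard) := by
  have h : Measurable (fun ω => (({i | ω ∈ E i}.encard : ℕ∞) : ℝ≥0∞)) := by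
    simp_rw [encard_setOf_eq_tsum_indicator]
    exact Measurable.tsum fun i => measurable_one.indicator (hE i)
  refine measurable_to_countable' fun k => ?_
  convert h (measurableSet_singleton (k : ℝ≥0∞)) using 1
  ext ω
  simp

lemma measurable_count (hX : ∀ i, Measurable (X i)) {A : Set Plane} (hA : MeasurableSet A) :
    Measurable (count X A) :=
  measurable_encard (E := fun i => X i ⁻¹' A) fun i => hX i hA

/-- The process prescribes only the probabilities of finite counts. They already sum to one, so the
value `⊤` carries no mass. -/
lemma IsPoissonProcess.map_count [IsProbabilityMeasure P] (hX : IsPoissonProcess P lam X)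
    {A : Set Plane} (hA : MeasurableSet A) (hAb : Bornology.IsBounded A) :
    P.map (count X A) =
      (poissonMeasure (lam * (volume A).toReal).toNNReal).map (Nat.cast : ℕ → ℕ∞) := by
  have hm := measurable_count hX.measurable hA
  have h (k : ℕ) : P.map (count X A) {(k : ℕ∞)} =
      (poissonMeasure (lam * (volume A).toReal).toNNReal).map (Nat.cast : ℕ → ℕ∞) {(k : ℕ∞)} := by
    rw [Measure.map_apply hm .of_discrete, Measure.map_apply .of_discrete .of_discrete]
    have hk : (Nat.cast : ℕ → ℕ∞) ⁻¹' {(k : ℕ∞)} = {k} := by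
      ext j
      simp
    rw [hk]
    exact hX.law_count A hA hAb k
  have hr : Measure.map (Nat.cast : ℕ → ℕ∞)
      (poissonMeasure (lam * (volume A).toReal).toNNReal) {⊤}ᶜ = 1 := by
    rw [Measure.map_apply .of_discrete .of_discrete,
      ← measure_univ (μ := poissonMeasure (lam * (volume A).toReal).toNNReal)]
    congr 1
    ext
    simp
  have hU : ({⊤}ᶜ : Set ℕ∞) = ⋃ k : ℕ, {(k : ℕ∞)} := by
    ext k
    simp only [Set.mem_compl_iff, Set.mem_singleton_iff, Set.mem_iUnion]
    exact ENat.ne_top_iff_exists.trans (by simp [eq_comm])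
  have hd : Pairwise (Function.onFun Disjoint fun k : ℕ => ({(k : ℕ∞)} : Set ℕ∞)) := by
    intro k l hkl
    simpa [Function.onFun] using hkl
  have hl : P.map (count X A) {⊤}ᶜ = 1 := by
    rw [← hr, hU, measure_iUnion hd fun _ => .of_discrete,
      measure_iUnion hd fun _ => .of_discrete]
    simp_rw [h]
  have := Measure.isProbabilityMeasure_map (μ := P) hm.aemeasurable
  refine Measure.ext_of_singleton fun k => ?_
  induction k using ENat.recTopCoe with
  | top =>
    rw [prob_compl_eq_one_iff .of_discrete] at hl hr
    rw [hl, hr]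
  | coe k => exact h k

lemma IsPoissonProcess.lintegral_count [IsProbabilityMeasure P] (hX : IsPoissonProcess P lam X)
    {A : Set Plane} (hA : MeasurableSet A) (hAb : Bornology.IsBounded A) (f : ℕ∞ → ℝ≥0∞) :
    ∫⁻ ω, f (count X A ω) ∂P =
      ∫⁻ k : ℕ, f k ∂(poissonMeasure (lam * (volume A).toReal).toNNReal) := by
  rw [← lintegral_map (μ := P) (f := f) .of_discrete (measurable_count hX.measurable hA),
    hX.map_count hA hAb, lintegral_map .of_discrete .of_discrete]

lemma IsPoissonProcess.expectedCount_count [IsProbabilityMeasure P]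
    (hX : IsPoissonProcess P lam X)
    {A : Set Plane} (hA : MeasurableSet A) (hAb : Bornology.IsBounded A) :
    expectedCount P (count X A) = ENNReal.ofReal (lam * (volume A).toReal) := by
  rw [expectedCount, hX.lintegral_count hA hAb (fun k => (k : ℝ≥0∞))]
  simp only [ENat.toENNReal_coe]
  rw [lintegral_natCast_poissonMeasure]
  rfl

lemma IsPoissonProcess.ae_count_ne_top [IsProbabilityMeasure P] (hX : IsPoissonProcess P lam X)
    {A : Set Plane} (hA : MeasurableSet A) (hAb : Bornology.IsBounded A) :
    ∀ᵐ ω ∂P, count X A ω ≠ ⊤ := by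
  have h : ∫⁻ ω, (count X A ω : ℝ≥0∞) ∂P ≠ ∞ := by
    have := hX.expectedCount_count hA hAb
    rw [expectedCount] at this
    simp [this]
  have hm : Measurable fun ω => (count X A ω : ℝ≥0∞) :=
    (Measurable.of_discrete (f := ENat.toENNReal)).comp (measurable_count hX.measurable hA)
  filter_upwards [ae_lt_top hm h] with ω hω
  simpa using hω.ne

end Points

/-! ### Comparison of independent marks -/

section Marks

variable {Ω : Type*} [MeasurableSpace Ω] {P : Measure Ω}

/-- The events "the k-th value is strictly lowest" are disjoint and, by exchangeability, equally
likely. Ties only lose mass, so the inequality needs no assumption that `ν` is atomless. -/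
lemma measure_forall_lt_le_inv_card [IsProbabilityMeasure P] {ι : Type*} [Fintype ι]
    {V : ι → Ω → ℝ} {ν : Measure ℝ} (hV : ∀ i, Measurable (V i)) (hlaw : ∀ i, P.map (V i) = ν)
    (hind : iIndepFun V P) (i : ι) :
    P {ω | ∀ j, j ≠ i → V i ω < V j ω} ≤ (Fintype.card ι : ℝ≥0∞)⁻¹ := by
  classical
  set B : ι → Set (ι → ℝ) := fun k => {v | ∀ j, j ≠ k → v k < v j}
  have hB (k) : MeasurableSet (B k) := by
    simp only [B, Set.ofPred_forall]
    exact .iInter fun j => .iInter fun _ =>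
      measurableSet_lt (measurable_pi_apply k) (measurable_pi_apply j)
  have hE (k) : MeasurableSet {ω | ∀ j, j ≠ k → V k ω < V j ω} :=
    measurable_pi_lambda (fun ω j => V j ω) hV (hB k)
  -- The joint law is a power of `ν`, hence invariant under swapping the coordinates `i` and `k`.
  have hsymm (k : ι) : P {ω | ∀ j, j ≠ k → V k ω < V j ω} =
      P {ω | ∀ j, j ≠ i → V i ω < V j ω} := by
    have h1 := hind.map_fun_eq_pi_map fun j => (hV j).aemeasurable
    have h2 := (hind.precomp (Equiv.swap i k).injective).map_fun_eq_pi_map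
      fun j => (hV _).aemeasurable
    simp only [hlaw] at h1 h2
    have h3 := congr_arg (fun μ => μ (B i)) (h1.trans h2.symm)
    beta_reduce at h3
    rw [Measure.map_apply (measurable_pi_lambda _ hV) (hB i),
      Measure.map_apply (measurable_pi_lambda _ fun j => hV _) (hB i)] at h3
    refine Eq.trans ?_ h3.symm
    congr 1
    ext ω
    simp only [B, Set.mem_ofPred_eq, Set.mem_preimage, Equiv.swap_apply_left]
    rw [(Equiv.swap i k).forall_congr_left]
    refine forall_congr' fun j => ?_
    rw [Equiv.symm_swap, Ne, Equiv.swap_apply_eq_iff, Equiv.swap_apply_right]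
  have hd : Pairwise (Function.onFun Disjoint fun k => {ω | ∀ j, j ≠ k → V k ω < V j ω}) := by
    intro k l hkl
    refine Set.disjoint_left.2 fun ω hk hl => ?_
    exact lt_asymm (hk l hkl.symm) (hl k hkl)
  have hsum : ∑ k, P {ω | ∀ j, j ≠ k → V k ω < V j ω} ≤ 1 := by
    rw [← tsum_fintype (L := .unconditional ι), ← measure_iUnion hd hE]
    exact prob_le_one
  simp only [hsymm, Finset.sum_const, Finset.card_univ, nsmul_eq_mul] at hsum
  rw [ENNReal.le_inv_iff_mul_le, mul_comm]
  exact hsum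

variable {M : ℕ} {X : ℕ → Ω → Plane} {U : ℕ → Fin M → Ω → ℝ}

lemma IsUniformMarking.measure_forall_lt_le [IsProbabilityMeasure P]
    (hU : IsUniformMarking P X U) (m : Fin M) {S : Finset ℕ} {i : ℕ} (hi : i ∈ S) :
    P {ω | ∀ j ∈ S, j ≠ i → U i m ω < U j m ω} ≤ (S.card : ℝ≥0∞)⁻¹ := by
  have hinj : Function.Injective fun j : S => ((j : ℕ), m) := fun j k h =>
    Subtype.ext (congrArg Prod.fst h)
  have h := measure_forall_lt_le_inv_card (V := fun (j : S) => U j m) (fun j => hU.measurable j m)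
    (fun j => hU.uniform j m) (hU.indep.precomp hinj) ⟨i, hi⟩
  rw [Fintype.card_coe] at h
  refine le_trans (measure_mono ?_) h
  exact fun ω hω j hji => hω j j.2 fun h => hji (Subtype.ext h)

/-- It suffices that all marks of `i` lie below 1/2 and all marks of `j` above it: finitely many
independent events of positive probability. -/
lemma IsUniformMarking.measure_forall_lt_pos [IsProbabilityMeasure P]
    (hU : IsUniformMarking P X U) {i j : ℕ} (hij : i ≠ j) :
    0 < P {ω | ∀ m, U i m ω < U j m ω} := by
  classical
  set s : ℕ × Fin M → Set ℝ := fun p => if p.1 = i then Set.Iio (1 / 2) else Set.Ioi (1 / 2)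
  have hs (p) : MeasurableSet (s p) := by
    simp only [s]
    split_ifs
    exacts [measurableSet_Iio, measurableSet_Ioi]
  have hpos (p : ℕ × Fin M) : P ((fun ω => U p.1 p.2 ω) ⁻¹' s p) ≠ 0 := by
    rw [← Measure.map_apply (hU.measurable p.1 p.2) (hs p), hU.uniform,
      Measure.restrict_apply (hs p)]
    refine ne_of_gt ?_
    simp only [s]
    split_ifs
    · refine lt_of_lt_of_le ?_ (measure_mono (s := Set.Ioo (0 : ℝ) (1 / 2)) ?_)
      · simp
      · intro x hx
        exact ⟨hx.2, hx.1.le, by linarith [hx.2]⟩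
    · refine lt_of_lt_of_le ?_ (measure_mono (s := Set.Ioo (1 / 2 : ℝ) 1) ?_)
      · rw [Real.volume_Ioo]
        norm_num
      · intro x hx
        exact ⟨hx.1, by linarith [hx.1], hx.2.le⟩
  have h := hU.indep.meas_biInter (S := ({i, j} : Finset ℕ) ×ˢ Finset.univ)
    (s := fun p => (fun ω => U p.1 p.2 ω) ⁻¹' s p) fun p _ => ⟨s p, hs p, rfl⟩
  refine lt_of_lt_of_le ?_ (measure_mono (s := ⋂ p ∈ ({i, j} : Finset ℕ) ×ˢ Finset.univ,
    (fun ω => U p.1 p.2 ω) ⁻¹' s p) ?_)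
  · rw [h]
    exact pos_iff_ne_zero.2 (Finset.prod_ne_zero_iff.2 fun p _ => hpos p)
  · intro ω hω m
    simp only [Set.mem_iInter] at hω
    have h1 := hω (i, m) (by simp)
    have h2 := hω (j, m) (by simp)
    simp only [s, Set.mem_preimage, if_pos, hij.symm, if_false, Set.mem_Iio, Set.mem_Ioi] at h1 h2
    exact h1.trans h2

end Marks

/-! ### The mean number of lowest marks in one cell -/

section Cells

variable {Ω : Type*} [MeasurableSpace Ω] {P : Measure Ω} {lam : ℝ} {M : ℕ} {X : ℕ → Ω → Plane}
  {U : ℕ → Fin M → Ω → ℝ}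

/-- The event is split according to the set `S` of indices of the points in `D`. Almost surely `S`
is finite, so there are countably many cases, and in each the marks are independent of the
positions. -/
lemma measure_mem_and_forall_lt_le [IsProbabilityMeasure P] (hX : IsPoissonProcess P lam X)
    (hU : IsUniformMarking P X U) (m : Fin M) {A D : Set Plane} (hA : MeasurableSet A)
    (hD : MeasurableSet D) (hDb : Bornology.IsBounded D) (hAD : A ⊆ D) (i : ℕ) :
    P {ω | X i ω ∈ A ∧ ∀ j, j ≠ i → X j ω ∈ D → U i m ω < U j m ω} ≤
      ∫⁻ ω in X i ⁻¹' A, (count X D ω : ℝ≥0∞)⁻¹ ∂P := by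
  set E := {ω | X i ω ∈ A ∧ ∀ j, j ≠ i → X j ω ∈ D → U i m ω < U j m ω}
  set C : Finset ℕ → Set (ℕ → Plane) := fun S => {x | x i ∈ A ∧ ∀ j, x j ∈ D ↔ j ∈ S}
  have hC (S) : MeasurableSet (C S) := by
    refine (measurable_pi_apply i hA).inter ?_
    change MeasurableSet {x : ℕ → Plane | ∀ j, x j ∈ D ↔ j ∈ S}
    rw [Set.ofPred_forall]
    refine .iInter fun j => ?_
    have hj : Measurable fun x : ℕ → Plane => x j ∈ D :=
      measurableSet_setOfPred.1 (measurable_pi_apply j hD)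
    exact measurableSet_setOfPred.2 (hj.iff measurable_const)
  have hXm : Measurable fun ω (j : ℕ) => X j ω := measurable_pi_lambda _ hX.measurable
  set H : Finset ℕ → Set Ω := fun S => (fun ω (j : ℕ) => X j ω) ⁻¹' C S
  have hH (S) : MeasurableSet (H S) := hXm (hC S)
  have hcount {S ω} (hω : ω ∈ H S) : (count X D ω : ℝ≥0∞) = S.card := by
    have : {j | X j ω ∈ D} = S := by
      ext j
      exact hω.2 j
    simp [count, this]
  have hE : P E ≤ P (⋃ S, E ∩ H S) := by
    refine measure_mono_ae ?_
    filter_upwards [hX.ae_count_ne_top hD hDb] with ω hω hωE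
    have hfin : {j | X j ω ∈ D}.Finite := by
      by_contra h
      exact hω (Set.encard_eq_top h)
    exact Set.mem_iUnion.2 ⟨hfin.toFinset, hωE, hωE.1, fun j => by simp⟩
  have hS (S : Finset ℕ) : P (E ∩ H S) ≤ ∫⁻ ω in H S, (count X D ω : ℝ≥0∞)⁻¹ ∂P := by
    by_cases hi : i ∈ S
    · set G : Set (ℕ × Fin M → ℝ) := {u | ∀ j ∈ S, j ≠ i → u (i, m) < u (j, m)}
      have hG : MeasurableSet G := by
        simp only [G, Set.ofPred_forall]
        exact .iInter fun j => .iInter fun _ => .iInter fun _ =>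
          measurableSet_lt (measurable_pi_apply _) (measurable_pi_apply _)
      calc P (E ∩ H S) ≤ P (H S ∩ (fun ω (p : ℕ × Fin M) => U p.1 p.2 ω) ⁻¹' G) :=
            measure_mono fun ω hω => ⟨hω.2, fun j hj hji => hω.1.2 j hji ((hω.2.2 j).2 hj)⟩
        _ = P (H S) * P ((fun ω (p : ℕ × Fin M) => U p.1 p.2 ω) ⁻¹' G) :=
            hU.indep_points.meas_inter ⟨C S, hC S, rfl⟩ ⟨G, hG, rfl⟩
        _ ≤ P (H S) * (S.card : ℝ≥0∞)⁻¹ := by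
            gcongr
            exact hU.measure_forall_lt_le m hi
        _ = ∫⁻ ω in H S, (count X D ω : ℝ≥0∞)⁻¹ ∂P := by
            rw [setLIntegral_congr_fun (g := fun _ => (S.card : ℝ≥0∞)⁻¹) (hH S)
              fun ω hω => by simp only [hcount hω]]
            rw [setLIntegral_const, mul_comm]
    · have : E ∩ H S = ∅ := by
        refine Set.eq_empty_of_forall_notMem fun ω hω => hi ((hω.2.2 i).1 (hAD hω.1.1))
      simp [this]
  have hd : Pairwise (Function.onFun Disjoint H) := by
    intro S T hST
    refine Set.disjoint_left.2 fun ω hS hT => hST ?_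
    ext j
    exact (hS.2 j).symm.trans (hT.2 j)
  calc P E ≤ ∑' S, P (E ∩ H S) := hE.trans (measure_iUnion_le _)
    _ ≤ ∑' S, ∫⁻ ω in H S, (count X D ω : ℝ≥0∞)⁻¹ ∂P := ENNReal.tsum_le_tsum hS
    _ = ∫⁻ ω in ⋃ S, H S, (count X D ω : ℝ≥0∞)⁻¹ ∂P := (lintegral_iUnion hH hd _).symm
    _ ≤ _ := lintegral_mono_set (Set.iUnion_subset fun S ω hω => hω.1)

lemma tsum_measure_mem_and_forall_lt_le [IsProbabilityMeasure P] (hX : IsPoissonProcess P lam X)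
    (hU : IsUniformMarking P X U) (m : Fin M) {A D D' : Set Plane} (hA : MeasurableSet A)
    (hD : MeasurableSet D) (hD' : MeasurableSet D') (hDb : Bornology.IsBounded D) (hAD : A ⊆ D)
    (hD'D : D' ⊆ D) (hdisj : Disjoint A D') :
    ∑' i, P {ω | X i ω ∈ A ∧ ∀ j, j ≠ i → X j ω ∈ D → U i m ω < U j m ω} ≤
      ENNReal.ofReal (lam * (volume A).toReal) *
        ENNReal.ofReal (∫ k : ℕ, 1 / (1 + (k : ℝ))
          ∂(poissonMeasure (lam * (volume D').toReal).toNNReal)) := by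
  have hm {A : Set Plane} (hA : MeasurableSet A) : Measurable fun ω => (count X A ω : ℝ≥0∞) :=
    (Measurable.of_discrete (f := ENat.toENNReal)).comp (measurable_count hX.measurable hA)
  have hind : IndepFun (count X A) (count X D') P := by
    have h := hX.indep_count 2 ![A, D'] (by simp [Fin.forall_fin_two, hA, hD'])
      (by simp [Fin.forall_fin_two, hDb.subset hAD, hDb.subset hD'D])
      (by
        intro j l hjl
        fin_cases j <;> fin_cases l <;> simp_all [hdisj.symm])
    exact h.indepFun (i := 0) (j := 1) (by simp)
  calc _ ≤ ∑' i, ∫⁻ ω in X i ⁻¹' A, (count X D ω : ℝ≥0∞)⁻¹ ∂P :=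
        ENNReal.tsum_le_tsum fun i => measure_mem_and_forall_lt_le hX hU m hA hD hDb hAD i
    _ = ∫⁻ ω, (count X A ω : ℝ≥0∞) * (count X D ω : ℝ≥0∞)⁻¹ ∂P := by
        have h1 (i : ℕ) : MeasurableSet (X i ⁻¹' A) := hX.measurable i hA
        simp_rw [← lintegral_indicator (h1 _)]
        rw [← lintegral_tsum (f := fun i => (X i ⁻¹' A).indicator fun ω => (count X D ω : ℝ≥0∞)⁻¹)
          fun i => (Measurable.indicator (hm hD).inv (h1 i)).aemeasurable]
        congr 1 with ω
        have h2 := encard_setOf_eq_tsum_indicator (fun i => X i ⁻¹' A) ω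
        simp only [Set.mem_preimage] at h2
        rw [count, h2, ← ENNReal.tsum_mul_right]
        congr 1 with i
        by_cases hi : X i ω ∈ A <;> simp [hi]
    -- Where the factor `count X A ω` is nonzero, `D` contains a point of `A` besides those of `D'`.
    -- The new denominator depends on `D'` alone, hence is independent of that factor.
    _ ≤ ∫⁻ ω, (count X A ω : ℝ≥0∞) * (1 + (count X D' ω : ℝ≥0∞))⁻¹ ∂P := by
        refine lintegral_mono fun ω => ?_
        rcases eq_or_ne (count X A ω) 0 with h0 | h0
        · simp [h0]
        · gcongr
          have h1 : (1 : ℕ∞) ≤ count X A ω := Order.one_le_iff_ne_zero.2 h0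
          have h2 : 1 + count X D' ω ≤ count X D ω := by
            refine (add_le_add_left h1 _).trans ?_
            rw [count, count, ← Set.encard_union_eq]
            · refine Set.encard_le_encard fun j hj => ?_
              rcases hj with hj | hj
              exacts [hAD hj, hD'D hj]
            · exact Set.disjoint_left.2 fun j h h' => Set.disjoint_left.1 hdisj h h'
          have h3 := ENat.toENNReal_le.2 h2
          simpa using h3
    _ = (∫⁻ ω, (count X A ω : ℝ≥0∞) ∂P) * ∫⁻ ω, (1 + (count X D' ω : ℝ≥0∞))⁻¹ ∂P :=
        lintegral_mul_eq_lintegral_mul_lintegral_of_indepFun'' (hm hA).aemeasurable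
          ((hm hD').const_add 1).inv.aemeasurable
          (hind.comp (φ := ENat.toENNReal) (ψ := fun k : ℕ∞ => (1 + (k : ℝ≥0∞))⁻¹)
            (Measurable.of_discrete (α := ℕ∞)) (Measurable.of_discrete (α := ℕ∞)))
    _ = _ := by
        congr 1
        · exact hX.expectedCount_count hA (hDb.subset hAD)
        · rw [hX.lintegral_count hD' (hDb.subset hD'D) fun k => (1 + (k : ℝ≥0∞))⁻¹]
          simp only [ENat.toENNReal_coe]
          exact lintegral_inv_one_add_poissonMeasure _

end Cells

open scoped Topology

/-! ### Selected caches in a disc, and caches that stay empty -/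

section Main

variable {Ω : Type*} [MeasurableSpace Ω] {P : Measure Ω} {lam : ℝ} {M : ℕ} {X : ℕ → Ω → Plane}
  {U : ℕ → Fin M → Ω → ℝ} {r : Fin M → ℝ}

lemma volume_closedBall_toReal (x : Plane) {R : ℝ} (hR : 0 ≤ R) :
    (volume (Metric.closedBall x R)).toReal = Real.pi * R ^ 2 := by
  rw [EuclideanSpace.volume_closedBall_fin_two, ENNReal.toReal_mul, ENNReal.toReal_pow,
    ENNReal.toReal_ofReal hR, ENNReal.toReal_ofReal Real.pi_pos.le, mul_comm]

lemma volume_ball_diff_ball_toReal (x : Plane) {s t : ℝ} (hs : 0 ≤ s) (hst : s ≤ t) :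
    (volume (Metric.ball x t \ Metric.ball x s)).toReal = Real.pi * (t ^ 2 - s ^ 2) := by
  rw [measure_sdiff (Metric.ball_subset_ball hst) measurableSet_ball.nullMeasurableSet
    measure_ball_lt_top.ne, ENNReal.toReal_sub_of_le (measure_mono (Metric.ball_subset_ball hst))
    measure_ball_lt_top.ne]
  simp only [EuclideanSpace.volume_ball_fin_two, ENNReal.toReal_mul, ENNReal.toReal_pow,
    ENNReal.toReal_ofReal hs, ENNReal.toReal_ofReal (hs.trans hst),
    ENNReal.toReal_ofReal Real.pi_pos.le]
  ring

lemma IsPoissonProcess.expectedCount_closedBall [IsProbabilityMeasure P]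
    (hX : IsPoissonProcess P lam X) (x : Plane) {R : ℝ} (hR : 0 ≤ R) :
    expectedCount P (count X (Metric.closedBall x R)) = ENNReal.ofReal (lam * Real.pi * R ^ 2) := by
  rw [hX.expectedCount_count measurableSet_closedBall Metric.isBounded_closedBall,
    volume_closedBall_toReal x hR, mul_assoc]

/-- Discretizing the plane into cells of diameter less than `2 * δ` bounds the mean number of
selected caches up to an error that vanishes as `δ → 0`. -/
lemma expectedCount_selectedCount_le_of_cells [IsProbabilityMeasure P] (hlam : 0 < lam)
    (hX : IsPoissonProcess P lam X) (hU : IsUniformMarking P X U) {R : ℝ} (hR : 0 ≤ R) (m : Fin M)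
    {δ : ℝ} (hδ : 0 < δ) (hδr : 2 * δ < r m) :
    expectedCount P (selectedCount r X U R m) ≤ ENNReal.ofReal (lam * Real.pi * R ^ 2) *
      ENNReal.ofReal ((1 - Real.exp (-(lam * (Real.pi * ((r m - δ) ^ 2 - δ ^ 2))))) /
        (lam * (Real.pi * ((r m - δ) ^ 2 - δ ^ 2)))) := by
  set c := TopologicalSpace.denseSeq Plane
  -- Balls of radius `δ` about a dense sequence cover the plane; making them disjoint partitions the
  -- disc.
  set A : ℕ → Set Plane := fun k =>
    Metric.closedBall 0 R ∩ disjointed (fun k => Metric.ball (c k) δ) k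
  have hAball (k) : A k ⊆ Metric.ball (c k) δ :=
    Set.inter_subset_right.trans (disjointed_subset _ k)
  have hAm (k) : MeasurableSet (A k) :=
    measurableSet_closedBall.inter (.disjointed (fun k => measurableSet_ball) k)
  have hAd : Pairwise (Function.onFun Disjoint A) := fun k l hkl =>
    (disjoint_disjointed _ hkl).mono Set.inter_subset_right Set.inter_subset_right
  have hAU : ⋃ k, A k = Metric.closedBall 0 R := by
    rw [← Set.inter_iUnion, iUnion_disjointed, Set.inter_eq_left]
    intro x _
    obtain ⟨k, hk⟩ := Metric.denseRange_iff.1 (TopologicalSpace.denseRange_denseSeq Plane) x δ hδ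
    exact Set.mem_iUnion.2 ⟨k, hk⟩
  -- With radius `r m - δ`, `D k` lies in the exclusion ball of every point of `A k`. As `2 * δ < r
  -- m`, it still contains `A k` and leaves an annulus of positive area around the `δ`-ball.
  set D : ℕ → Set Plane := fun k => Metric.ball (c k) (r m - δ)
  set E : ℕ → ℕ → Set Ω := fun k i =>
    {ω | X i ω ∈ A k ∧ ∀ j, j ≠ i → X j ω ∈ D k → U i m ω < U j m ω}
  have hE (k i) : MeasurableSet (E k i) := by
    refine (hX.measurable i (hAm k)).inter ?_
    change MeasurableSet {ω | ∀ j, j ≠ i → X j ω ∈ D k → U i m ω < U j m ω}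
    rw [Set.ofPred_forall]
    refine .iInter fun j => measurableSet_setOfPred.2 ?_
    have h1 : Measurable fun ω => X j ω ∈ D k :=
      measurableSet_setOfPred.1 (hX.measurable j measurableSet_ball)
    have h2 : Measurable fun ω => U i m ω < U j m ω :=
      measurableSet_setOfPred.1 (measurableSet_lt (hU.measurable i m) (hU.measurable j m))
    exact measurable_const.imp (h1.imp h2)
  have hsel (ω) : selectedCount r X U R m ω ≤ {i | ω ∈ ⋃ k, E k i}.encard := by
    refine Set.encard_le_encard fun i hi => ?_
    obtain ⟨k, hk⟩ := Set.mem_iUnion.1 (hAU.symm ▸ hi.1 : X i ω ∈ ⋃ k, A k)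
    refine Set.mem_iUnion.2 ⟨k, hk, fun j hji hj => hi.2 j hji ?_⟩
    have h1 := Metric.mem_ball.1 (hAball k hk)
    have h2 := Metric.mem_ball.1 hj
    rw [Metric.mem_closedBall]
    linarith [dist_triangle_right (X j ω) (X i ω) (c k)]
  have hcell (k : ℕ) : ∑' i, P (E k i) ≤ ENNReal.ofReal (lam * (volume (A k)).toReal) *
      ENNReal.ofReal ((1 - Real.exp (-(lam * (Real.pi * ((r m - δ) ^ 2 - δ ^ 2))))) /
        (lam * (Real.pi * ((r m - δ) ^ 2 - δ ^ 2)))) := by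
    have h := tsum_measure_mem_and_forall_lt_le hX hU m (D := D k)
      (D' := D k \ Metric.ball (c k) δ) (hAm k) measurableSet_ball
      (measurableSet_ball.diff measurableSet_ball) Metric.isBounded_ball
      ((hAball k).trans (Metric.ball_subset_ball (by linarith))) Set.sdiff_subset
      (Set.disjoint_sdiff_right.mono_left (hAball k))
    rw [volume_ball_diff_ball_toReal _ hδ.le (by linarith),
      integral_one_div_one_add_poissonMeasure] at h
    · exact h
    · have : 0 < (r m - δ) ^ 2 - δ ^ 2 := by nlinarith
      positivity
  -- The lower integral is monotone for arbitrary functions, so measurability of `selectedCount` is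
  -- not needed.
  calc expectedCount P (selectedCount r X U R m)
      ≤ expectedCount P (fun ω => {i | ω ∈ ⋃ k, E k i}.encard) :=
        lintegral_mono fun ω => ENat.toENNReal_le.2 (hsel ω)
    _ = ∑' i, P (⋃ k, E k i) := expectedCount_eq_tsum P fun i => .iUnion fun k => hE k i
    _ ≤ ∑' i, ∑' k, P (E k i) := ENNReal.tsum_le_tsum fun i => measure_iUnion_le _
    _ = ∑' k, ∑' i, P (E k i) := ENNReal.tsum_comm
    _ ≤ _ := ENNReal.tsum_le_tsum hcell
    _ = _ := by
        rw [ENNReal.tsum_mul_right]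
        congr 1
        have hfin (k) : volume (A k) ≠ ∞ := ne_top_of_le_ne_top
          (measure_closedBall_lt_top (x := (0 : Plane)) (r := R)).ne
          (measure_mono Set.inter_subset_left)
        simp_rw [ENNReal.ofReal_mul hlam.le, ENNReal.ofReal_toReal (hfin _)]
        rw [ENNReal.tsum_mul_left, ← measure_iUnion hAd hAm, hAU, mul_assoc,
          ENNReal.ofReal_mul hlam.le, ← volume_closedBall_toReal 0 hR, ENNReal.ofReal_toReal measure_closedBall_lt_top.ne]

/-- The cell bound is continuous at `δ = 0`, where the annulus has become the full disc of radius `r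
m` and the bound is the caching probability. -/
lemma expectedCount_selectedCount_le [IsProbabilityMeasure P] (hlam : 0 < lam)
    (hX : IsPoissonProcess P lam X) (hU : IsUniformMarking P X U) {R : ℝ} (hR : 0 ≤ R) (m : Fin M)
    (hr : 0 < r m) :
    expectedCount P (selectedCount r X U R m) ≤
      ENNReal.ofReal (lam * Real.pi * R ^ 2) * ENNReal.ofReal (cachingProb lam (r m)) := by
  have hpos : 0 < lam * Real.pi * r m ^ 2 := by positivity
  have hlim : Filter.Tendsto
      (fun δ : ℝ => (1 - Real.exp (-(lam * (Real.pi * ((r m - δ) ^ 2 - δ ^ 2))))) /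
        (lam * (Real.pi * ((r m - δ) ^ 2 - δ ^ 2)))) (𝓝[>] 0) (𝓝 (cachingProb lam (r m))) := by
    have h : ContinuousAt
        (fun δ : ℝ => (1 - Real.exp (-(lam * (Real.pi * ((r m - δ) ^ 2 - δ ^ 2))))) /
          (lam * (Real.pi * ((r m - δ) ^ 2 - δ ^ 2)))) 0 := by
      refine ContinuousAt.div (by fun_prop) (by fun_prop) ?_
      have : (r m - 0) ^ 2 - (0 : ℝ) ^ 2 = r m ^ 2 := by ring
      rw [this]
      positivity
    have h0 := h.tendsto
    rw [cachingProb, integral_one_div_one_add_poissonMeasure hpos]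
    convert h0.mono_left nhdsWithin_le_nhds using 2
    ring_nf
  refine ge_of_tendsto (ENNReal.Tendsto.const_mul (ENNReal.tendsto_ofReal hlim)
    (Or.inr ENNReal.ofReal_ne_top)) ?_
  filter_upwards [Ioo_mem_nhdsGT (half_pos hr)] with δ hδ
  exact expectedCount_selectedCount_le_of_cells hlam hX hU hR m hδ.1 (by linarith [hδ.2])

/-- Exactly two points fall in `A` with positive probability, and countably many index pairs cover
that event. -/
lemma IsPoissonProcess.exists_measure_two_mem_pos [IsProbabilityMeasure P] (hlam : 0 < lam)
    (hX : IsPoissonProcess P lam X) {A : Set Plane} (hA : MeasurableSet A)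
    (hAb : Bornology.IsBounded A) (hpos : 0 < (volume A).toReal) :
    ∃ i j, i ≠ j ∧ 0 < P {ω | X i ω ∈ A ∧ X j ω ∈ A} := by
  by_contra! h
  have h2 : P {ω | count X A ω = (2 : ℕ)} ≠ 0 := by
    rw [hX.law_count A hA hAb, poissonMeasure_singleton]
    have : 0 < (lam * (volume A).toReal).toNNReal := Real.toNNReal_pos.2 (mul_pos hlam hpos)
    exact (ENNReal.ofReal_pos.2 (by positivity)).ne'
  refine h2 (measure_mono_null (t := ⋃ i, ⋃ j, ⋃ _ : i ≠ j, {ω | X i ω ∈ A ∧ X j ω ∈ A}) ?_ ?_)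
  · intro ω hω
    obtain ⟨i, j, hij, h⟩ := Set.encard_eq_two.1 (show {i | X i ω ∈ A}.encard = 2 from hω)
    simp only [Set.mem_iUnion]
    refine ⟨i, j, hij, ?_, ?_⟩
    · exact (h.symm ▸ Set.mem_insert i {j} : i ∈ {i | X i ω ∈ A})
    · exact (h.symm ▸ Set.mem_insert_of_mem i rfl : j ∈ {i | X i ω ∈ A})
  · simp only [measure_iUnion_null_iff]
    exact fun i j hij => nonpos_iff_eq_zero.1 (h i j hij)

/-- Two close caches, one of which has the lower mark for every file: the other one stays empty. -/
lemma expectedCount_fullCount_lt [IsProbabilityMeasure P] (hlam : 0 < lam)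
    (hX : IsPoissonProcess P lam X) (hU : IsUniformMarking P X U) (hr : ∀ m, 0 < r m) {R : ℝ}
    (hR : 0 < R) {N : ℕ} (hN : 1 ≤ N) :
    expectedCount P (fullCount N r X U R) <
      expectedCount P (count X (Metric.closedBall 0 R)) := by
  -- Two points within `ε` of the origin lie in the receiver's disc and in each other's exclusion
  -- balls for every file.
  obtain ⟨ε, hε, hεR, hεr⟩ : ∃ ε : ℝ, 0 < ε ∧ ε ≤ R ∧ ∀ m, 2 * ε ≤ r m := by
    obtain ⟨s, hs, hsr⟩ : ∃ s : ℝ, 0 < s ∧ ∀ m, s ≤ r m := by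
      rcases isEmpty_or_nonempty (Fin M) with _ | _
      · exact ⟨1, one_pos, isEmptyElim⟩
      · obtain ⟨m, hm⟩ := Finite.exists_min r
        exact ⟨r m, hr m, hm⟩
    exact ⟨min R (s / 2), lt_min hR (half_pos hs), min_le_left _ _, fun m => by
      linarith [min_le_right R (s / 2), hsr m]⟩
  set B : Set Plane := Metric.closedBall 0 ε
  obtain ⟨i, j, hij, hpos⟩ := hX.exists_measure_two_mem_pos hlam (A := B) measurableSet_closedBall
    Metric.isBounded_closedBall (by rw [volume_closedBall_toReal 0 hε.le]; positivity)
  set C : Set (ℕ → Plane) := {x | x i ∈ B ∧ x j ∈ B}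
  set G : Set (ℕ × Fin M → ℝ) := {u | ∀ m, u (i, m) < u (j, m)}
  have hC : MeasurableSet C := (measurable_pi_apply i measurableSet_closedBall).inter
    (measurable_pi_apply j measurableSet_closedBall)
  have hG : MeasurableSet G := by
    simp only [G, Set.ofPred_forall]
    exact .iInter fun m => measurableSet_lt (measurable_pi_apply _) (measurable_pi_apply _)
  set F : Set Ω := (fun ω (i : ℕ) => X i ω) ⁻¹' C ∩
    (fun ω (p : ℕ × Fin M) => U p.1 p.2 ω) ⁻¹' G
  have hF : MeasurableSet F := (measurable_pi_lambda _ hX.measurable hC).inter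
    (measurable_pi_lambda _ (fun p : ℕ × Fin M => hU.measurable p.1 p.2) hG)
  have hFpos : 0 < P F := by
    rw [hU.indep_points.meas_inter ⟨C, hC, rfl⟩ ⟨G, hG, rfl⟩]
    exact ENNReal.mul_pos hpos.ne' (hU.measure_forall_lt_pos hij).ne'
  -- On `F`, cache `j` is counted on the right but is selected for no file. Being empty, it is not
  -- full because `N ≥ 1`.
  have hle (ω : Ω) : (fullCount N r X U R ω : ℝ≥0∞) + F.indicator 1 ω ≤
      count X (Metric.closedBall 0 R) ω := by
    by_cases hω : ω ∈ F
    · have hsel (m : Fin M) : ¬ Selected r X U m j ω := by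
        intro h
        refine lt_asymm (hω.2 m) (h i hij ?_)
        have h1 := Metric.mem_closedBall.1 hω.1.1
        have h2 := Metric.mem_closedBall.1 hω.1.2
        rw [Metric.mem_closedBall]
        linarith [dist_triangle_right (X i ω) (X j ω) 0, hεr m]
      have hj : j ∉ {i : ℕ | X i ω ∈ Metric.closedBall 0 R ∧
          {m : Fin M | Stores N r X U m i ω}.ncard = N} := by
        rintro ⟨-, h⟩
        have : {m : Fin M | Stores N r X U m j ω} = ∅ :=
          Set.eq_empty_of_forall_notMem fun m hm => hsel m hm.1
        rw [this, Set.ncard_empty] at h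
        omega
      have h : fullCount N r X U R ω + 1 ≤ count X (Metric.closedBall 0 R) ω := by
        rw [fullCount, ← Set.encard_insert_of_notMem hj]
        refine Set.encard_le_encard (Set.insert_subset ?_ fun k hk => hk.1)
        exact Metric.closedBall_subset_closedBall hεR hω.1.2
      simpa [hω] using ENat.toENNReal_le.2 h
    · have h : fullCount N r X U R ω ≤ count X (Metric.closedBall 0 R) ω :=
        Set.encard_le_encard fun k hk => hk.1
      simpa [hω] using h
  have hsum : expectedCount P (fullCount N r X U R) + P F ≤
      expectedCount P (count X (Metric.closedBall 0 R)) := by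
    rw [expectedCount, ← lintegral_indicator_one hF,
      ← lintegral_add_right _ (measurable_one.indicator hF)]
    exact lintegral_mono hle
  -- Adding `P F > 0` gives a strict increase only if this expectation is finite.
  have hfin : expectedCount P (fullCount N r X U R) ≠ ∞ := by
    refine ne_top_of_le_ne_top ?_ (le_self_add.trans hsum)
    rw [hX.expectedCount_closedBall 0 hR.le]
    exact ENNReal.ofReal_ne_top
  exact (ENNReal.lt_add_right hfin hFpos.ne').trans_le hsum

lemma cachingProb_nonneg (lam r : ℝ) : 0 ≤ cachingProb lam r :=
  integral_nonneg fun k => by positivity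

end Main

end HardCore

/-! ### Summation over the files -/

theorem mainTheorem8 {Ω : Type*} [MeasurableSpace Ω] (P : Measure Ω) [IsProbabilityMeasure P]
    (lam R : ℝ) (hlam : 0 < lam) (hR : 0 < R)
    (M N : ℕ) (hN : 1 ≤ N) (hNM : N < M)
    (X : ℕ → Ω → HardCore.Plane) (hX : HardCore.IsPoissonProcess P lam X)
    (U : ℕ → Fin M → Ω → ℝ) (hU : HardCore.IsUniformMarking P X U)
    (r : Fin M → ℝ) (hr : ∀ m, 0 < r m)
    (hcache : ∑ m, HardCore.cachingProb lam (r m) ≤ N) :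
    HardCore.expectedCount P (HardCore.count X (Metric.closedBall 0 R))
        = ENNReal.ofReal (lam * Real.pi * R ^ 2) ∧
    (∑ m, HardCore.expectedCount P (HardCore.selectedCount r X U R m)) /
        (N * HardCore.expectedCount P (HardCore.count X (Metric.closedBall 0 R))) ≤ 1 ∧
    (∑ m, HardCore.expectedCount P (HardCore.storedCount N r X U R m)) /
        (N * HardCore.expectedCount P (HardCore.count X (Metric.closedBall 0 R))) ≤ 1 ∧
    HardCore.expectedCount P (HardCore.fullCount N r X U R) /
        HardCore.expectedCount P (HardCore.count X (Metric.closedBall 0 R)) < 1 := by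
  have hcount := hX.expectedCount_closedBall 0 hR.le
  have hpos : 0 < lam * Real.pi * R ^ 2 := by positivity
  have hsel : ∑ m, HardCore.expectedCount P (HardCore.selectedCount r X U R m) ≤
      N * HardCore.expectedCount P (HardCore.count X (Metric.closedBall 0 R)) := by
    calc _ ≤ ∑ m, ENNReal.ofReal (lam * Real.pi * R ^ 2) *
          ENNReal.ofReal (HardCore.cachingProb lam (r m)) := Finset.sum_le_sum fun m _ =>
            HardCore.expectedCount_selectedCount_le hlam hX hU hR.le m (hr m)
      _ = ENNReal.ofReal (lam * Real.pi * R ^ 2) *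
          ENNReal.ofReal (∑ m, HardCore.cachingProb lam (r m)) := by
            rw [← Finset.mul_sum, ENNReal.ofReal_sum_of_nonneg fun m _ =>
              HardCore.cachingProb_nonneg lam (r m)]
      _ ≤ ENNReal.ofReal (lam * Real.pi * R ^ 2) * ENNReal.ofReal N := by gcongr
      _ = _ := by rw [hcount, ENNReal.ofReal_natCast, mul_comm]
  have hstored : ∑ m, HardCore.expectedCount P (HardCore.storedCount N r X U R m) ≤
      ∑ m, HardCore.expectedCount P (HardCore.selectedCount r X U R m) :=
    Finset.sum_le_sum fun m _ => lintegral_mono fun ω =>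
      ENat.toENNReal_le.2 (Set.encard_le_encard fun i hi => ⟨hi.1, hi.2.1⟩)
  refine ⟨hcount, ENNReal.div_le_of_le_mul (by rwa [one_mul]),
    ENNReal.div_le_of_le_mul (by rw [one_mul]; exact hstored.trans hsel), ?_⟩
  rw [ENNReal.div_lt_iff (Or.inl (by rw [hcount]; exact (ENNReal.ofReal_pos.2 hpos).ne'))
    (Or.inl (by rw [hcount]; exact ENNReal.ofReal_ne_top)), one_mul]
  exact HardCore.expectedCount_fullCount_lt hlam hX hU hr hR hN
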